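/- Let $n,m\in\mathbb{R}$ be arbitrary. For an integer $k\ge 1$ let $H^k=W^{k,2}(\mathbb{R})$ be the real Sobolev space of functions with $L^2$ weak derivatives up to order $k$, with norm $\|f\|_{H^k}^2=\sum_{j=0}^{k}\|\partial_z^j f\|_{L^2}^2$. For $0<T\le\infty$ a function $\phi=\phi(z,t)>0$ with $\phi-1\in C^1([0,T);H^k)$ is called a solution, with initial value $\phi_0$, of $$\bigl(\phi^m-\partial_z\,\phi^n\,\partial_z\bigr)\bigl[\phi^{-m}\phi_t\bigr]=-(\phi^n)_z$$ if $\phi(\cdot,0)=\phi_0$ and, for every $t\in[0,T)$, $\phi_t=\phi^m u$ where $u=u(\cdot,t)\in H^1$ is the weak solution of $-(\phi^n u_z)_z+\phi^m u=-(\phi^n)_z$, that is, $\int_{\mathbb{R}}\bigl(\phi^n u_z v_z+\phi^m u v\bigr)\,dz=-\int_{\mathbb{R}}(\phi^n)_z\,v\,dz$ for all $v\in H^1$. (For each $t$, $\phi(\cdot,t)$ is identified with its continuous representative.) Then the uniform state $\phi\equiv 1$ is nonlinearly (Lyapunov) stable in $H^1$: there exists $\epsilon_c=\epsilon_c(n,m)>0$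 such that for every $0<\epsilon<\epsilon_c$ there exists $\delta=\delta(\epsilon,n,m)>0$ such that for every integer $k\ge1$, every $0<T\le\infty$, every initial value $\phi_0$, and every solution $\phi$ with $\phi-1\in C^1([0,T);H^k)$ and $\phi(\cdot,0)=\phi_0$, $$\|\phi_0-1\|_{H^1}\le\delta\quad\Longrightarrow\quad \|\phi(\cdot,t)-1\|_{H^1}\le\epsilon\quad\text{for all } 0\le t<T.$$ -/

import Mathlib

open MeasureTheory Set
open scoped ENNReal ContDiff

/-- `g` is the weak derivative of `f` on `ℝ`, tested against smooth compactly supported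
functions. -/
def HasWeakDeriv (f g : ℝ → ℝ) : Prop :=
  LocallyIntegrable f volume ∧ LocallyIntegrable g volume ∧
    ∀ ψ : ℝ → ℝ, ContDiff ℝ ∞ ψ → HasCompactSupport ψ →
      ∫ z, f z * deriv ψ z = -∫ z, g z * ψ z

theorem HasWeakDeriv.zero {f g : ℝ → ℝ} (hf : f =ᵐ[volume] 0) (hg : g =ᵐ[volume] 0) :
    HasWeakDeriv f g := by
  refine ⟨(locallyIntegrable_zero).congr hf.symm, (locallyIntegrable_zero).congr hg.symm, ?_⟩
  intro ψ _ _
  rw [integral_eq_zero_of_ae, integral_eq_zero_of_ae, neg_zero]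
  · filter_upwards [hg] with z hz
    simp [hz]
  · filter_upwards [hf] with z hz
    simp [hz]

theorem HasWeakDeriv.congr {f f' g g' : ℝ → ℝ} (h : HasWeakDeriv f g)
    (hf : f' =ᵐ[volume] f) (hg : g' =ᵐ[volume] g) : HasWeakDeriv f' g' := by
  refine ⟨h.1.congr hf.symm, h.2.1.congr hg.symm, ?_⟩
  intro ψ hψ hc
  have h1 : ∫ z, f' z * deriv ψ z = ∫ z, f z * deriv ψ z := by
    apply integral_congr_ae
    filter_upwards [hf] with z hz
    rw [hz]
  have h2 : ∫ z, g' z * ψ z = ∫ z, g z * ψ z := by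
    apply integral_congr_ae
    filter_upwards [hg] with z hz
    rw [hz]
  rw [h1, h2, h.2.2 ψ hψ hc]

theorem HasWeakDeriv.add {f f' g g' : ℝ → ℝ} (h : HasWeakDeriv f g)
    (h' : HasWeakDeriv f' g') : HasWeakDeriv (f + f') (g + g') := by
  refine ⟨h.1.add h'.1, h.2.1.add h'.2.1, ?_⟩
  intro ψ hψ hc
  have hd : Continuous (deriv ψ) := hψ.continuous_deriv (by simp)
  have i1 : Integrable (fun z => f z * deriv ψ z) :=
    h.1.integrable_smul_right_of_hasCompactSupport hd hc.deriv
  have i2 : Integrable (fun z => f' z * deriv ψ z) :=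
    h'.1.integrable_smul_right_of_hasCompactSupport hd hc.deriv
  have i3 : Integrable (fun z => g z * ψ z) :=
    h.2.1.integrable_smul_right_of_hasCompactSupport hψ.continuous hc
  have i4 : Integrable (fun z => g' z * ψ z) :=
    h'.2.1.integrable_smul_right_of_hasCompactSupport hψ.continuous hc
  simp only [Pi.add_apply, add_mul]
  rw [integral_add i1 i2, integral_add i3 i4, h.2.2 ψ hψ hc, h'.2.2 ψ hψ hc]
  ring

theorem HasWeakDeriv.smul {f g : ℝ → ℝ} (h : HasWeakDeriv f g) (c : ℝ) :
    HasWeakDeriv (c • f) (c • g) := by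
  refine ⟨h.1.smul c, h.2.1.smul c, ?_⟩
  intro ψ hψ hc
  simp only [Pi.smul_apply, smul_eq_mul, mul_assoc]
  rw [integral_const_mul, integral_const_mul, h.2.2 ψ hψ hc]
  ring

/-- The real Sobolev space `H^k(ℝ) = W^{k,2}(ℝ)`. An element is stored as the tuple
`(f, f', …, f^{(k)})` of its weak derivatives, all in `L²(ℝ)`; the norm inherited from the
`ℓ²`-product is `‖f‖² = ∑_{j ≤ k} ‖f^{(j)}‖²_{L²}`. -/
def SobolevSpace (k : ℕ) :
    Submodule ℝ (PiLp 2 (fun _ : Fin (k + 1) => Lp ℝ 2 (volume : Measure ℝ))) where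
  carrier := {F | ∀ j : Fin k, HasWeakDeriv (F j.castSucc) (F j.succ)}
  zero_mem' := fun _ => HasWeakDeriv.zero (Lp.coeFn_zero _ _ _) (Lp.coeFn_zero _ _ _)
  add_mem' := fun {F G} hF hG j =>
    ((hF j).add (hG j)).congr (Lp.coeFn_add (F j.castSucc) (G j.castSucc))
      (Lp.coeFn_add (F j.succ) (G j.succ))
  smul_mem' := fun c F hF j =>
    ((hF j).smul c).congr (Lp.coeFn_smul c (F j.castSucc)) (Lp.coeFn_smul c (F j.succ))

/-- The `j`-th weak derivative of an element of `H^k(ℝ)`, as an element of `L²(ℝ)`. -/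
def wderiv {k : ℕ} (p : SobolevSpace k) (j : Fin (k + 1)) :
    Lp ℝ 2 (volume : Measure ℝ) :=
  p.1 j

/-- The element `p` of `H^k(ℝ)` is the class of the function `f`. -/
def Represents {k : ℕ} (p : SobolevSpace k) (f : ℝ → ℝ) : Prop :=
  wderiv p 0 =ᵐ[volume] f

/-- The `H^k(ℝ)` norm of a function, equal to `∞` when the function is not in `H^k(ℝ)`
(the class `p` in the infimum is unique when it exists). -/
noncomputable def sobolevENorm (k : ℕ) (f : ℝ → ℝ) : ℝ≥0∞ :=
  ⨅ (p : SobolevSpace k) (_ : Represents p f), ‖p‖ₑ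

/-- For a positive function `φ` and `u ∈ H¹(ℝ)`, the equation
`-(φⁿ u_z)_z + φᵐ u = -(φⁿ)_z` with right-hand side in `L²(ℝ)`, in its weak form:
`∫ (φⁿ u_z v_z + φᵐ u v) = -∫ (φⁿ)_z v` for all `v ∈ H¹(ℝ)`. -/
def SolvesElliptic (n m : ℝ) (φ : ℝ → ℝ) (u : SobolevSpace 1) : Prop :=
  ∃ g : Lp ℝ 2 (volume : Measure ℝ), HasWeakDeriv (fun z => φ z ^ n) g ∧
    ∀ v : SobolevSpace 1,
      ∫ z, (φ z ^ n * wderiv u 1 z * wderiv v 1 z + φ z ^ m * wderiv u 0 z * wderiv v 0 z) =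
        -∫ z, g z * wderiv v 0 z

/-- The time interval `[0, T)`, with `T = ∞` allowed. -/
def timeInterval (T : EReal) : Set ℝ :=
  {t | 0 ≤ t ∧ (t : EReal) < T}

/-- `φ t z` is a solution, with `φ - 1 ∈ C¹([0, T), H^k(ℝ))` and initial value `φ₀`, of
`(φᵐ - ∂_z φⁿ ∂_z)[φ⁻ᵐ φ_t] = -(φⁿ)_z`, that is, of `φ_t = φᵐ u`,
`(φᵐ - ∂_z φⁿ ∂_z) u = -(φⁿ)_z`. Each `φ t` is the continuous representative of its class,
and it is positive. -/
structure IsMagmaSolution (n m : ℝ) (k : ℕ) (T : EReal) (φ₀ : ℝ → ℝ) (φ : ℝ → ℝ → ℝ) :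
    Prop where
  initial : φ 0 = φ₀
  continuous : ∀ t ∈ timeInterval T, Continuous (φ t)
  pos : ∀ t ∈ timeInterval T, ∀ z, 0 < φ t z
  equation : ∃ p : ℝ → SobolevSpace k, ContDiffOn ℝ 1 p (timeInterval T) ∧
    (∀ t ∈ timeInterval T, Represents (p t) (fun z => φ t z - 1)) ∧
    ∀ t ∈ timeInterval T, ∃ u : SobolevSpace 1, SolvesElliptic n m (φ t) u ∧
      Represents (derivWithin p (timeInterval T) t) (fun z => φ t z ^ m * wderiv u 0 z)

/-! The proof is Lyapunov's method with a conserved energy. Let `V'' = x^(-m-n)` with `V 1 = V' 1 =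
0`, and put `E(φ) = ∫ (½ φ^(-2m) φ_z² + V(φ))`. In the direction `φ_t = φ^m u` the two terms in
`φ_z² u` cancel, because `½ (x^(-2m))' = -m x^(-2m-1)`. What remains is `∫ (φ^(-m) φ_z u_z + φ^m u
V'(φ))`, which is the left side of the weak elliptic equation tested with `v = V'(φ)`. Its right
side is `-∫ (φ^n)_z V'(φ)`, the integral of a total derivative, hence zero. This is
`integral_energyDensityDeriv_eq_zero`.

If `‖φ - 1‖_{H¹} ≤ 1/2`, the embedding `|f| ≤ ‖f‖_{H¹}` (`abs_le_norm`) keeps `φ` in `[1/2, 3/2]`.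
There all powers are smooth and bounded, and `E` lies between two multiples of `‖φ - 1‖²`
(`le_energy`, `energy_le`). The same bounds make `E` Fréchet differentiable on the open ball of
radius `1/2` in `H¹` (`hasFDerivAt_energy`), so `E` is constant along a solution while it stays
there. A first-exit argument (`norm_le_of_energy_const`) concludes.

Weak derivatives are handled through locally absolutely continuous representatives, for which the
product and chain rules hold almost everywhere. -/

/-! ### Calculus of locally absolutely continuous functions. -/

/-- `f` is locally absolutely continuous on `ℝ`, with derivative `g` almost everywhere. -/
structure LocACDeriv (f g : ℝ → ℝ) : Prop where
  ac : ∀ a b, AbsolutelyContinuousOnInterval f a b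
  ae_hasDerivAt : ∀ᵐ x, HasDerivAt f (g x) x

theorem AbsolutelyContinuousOnInterval.lipschitzOnWith_comp {A f : ℝ → ℝ} {a b : ℝ} {s : Set ℝ}
    {K : NNReal} (hA : LipschitzOnWith K A s) (hs : ∀ x, f x ∈ s)
    (hf : AbsolutelyContinuousOnInterval f a b) :
    AbsolutelyContinuousOnInterval (fun x => A (f x)) a b := by
  rw [absolutelyContinuousOnInterval_iff] at hf ⊢
  intro ε hε
  obtain ⟨δ, hδ, h⟩ := hf (ε / (K + 1)) (by positivity)
  refine ⟨δ, hδ, fun E hE hs' => ?_⟩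
  have h1 := h E hE hs'
  calc _ ≤ ∑ i ∈ Finset.range E.1, K * dist (f (E.2 i).1) (f (E.2 i).2) :=
        Finset.sum_le_sum fun i _ => hA.dist_le_mul _ (hs _) _ (hs _)
    _ = K * ∑ i ∈ Finset.range E.1, dist (f (E.2 i).1) (f (E.2 i).2) := by
        rw [Finset.mul_sum]
    _ ≤ (K + 1) * ∑ i ∈ Finset.range E.1, dist (f (E.2 i).1) (f (E.2 i).2) := by
        gcongr
        linarith
    _ < (K + 1) * (ε / (K + 1)) := by gcongr
    _ = ε := by field_simp

namespace LocACDeriv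

variable {f g f' g' : ℝ → ℝ}

theorem congr (h : LocACDeriv f g) (hg : g' =ᵐ[volume] g) : LocACDeriv f g' :=
  ⟨h.ac, by filter_upwards [h.ae_hasDerivAt, hg] with x hx hgx; rwa [hgx]⟩

theorem continuous (h : LocACDeriv f g) : Continuous f := by
  rw [continuous_iff_continuousAt]
  intro x
  have := (h.ac (x - 1) (x + 1)).continuousOn
  exact this.continuousAt (by
    rw [uIcc_of_le (by linarith)]
    exact Icc_mem_nhds (by linarith) (by linarith))

theorem ae_eq_deriv (h : LocACDeriv f g) : g =ᵐ[volume] deriv f := by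
  filter_upwards [h.ae_hasDerivAt] with x hx using hx.deriv.symm

theorem ae_unique (h : LocACDeriv f g) (h' : LocACDeriv f g') : g =ᵐ[volume] g' :=
  h.ae_eq_deriv.trans h'.ae_eq_deriv.symm

theorem intervalIntegrable (h : LocACDeriv f g) (a b : ℝ) :
    IntervalIntegrable g volume a b :=
  (h.ac a b).intervalIntegrable_deriv.congr_ae (ae_restrict_of_ae h.ae_eq_deriv.symm)

theorem integral_eq (h : LocACDeriv f g) (a b : ℝ) : ∫ x in a..b, g x = f b - f a := by
  rw [← (h.ac a b).integral_deriv_eq_sub]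
  apply intervalIntegral.integral_congr_ae
  filter_upwards [h.ae_eq_deriv] with x hx _ using hx

theorem locallyIntegrable (h : LocACDeriv f g) : LocallyIntegrable g volume := by
  intro x
  refine ⟨Icc (x - 1) (x + 1), Icc_mem_nhds (by linarith) (by linarith), ?_⟩
  rw [← intervalIntegrable_iff_integrableOn_Icc_of_le (by linarith)]
  exact h.intervalIntegrable _ _

theorem mul (h : LocACDeriv f g) (h' : LocACDeriv f' g') :
    LocACDeriv (fun x => f x * f' x) (fun x => g x * f' x + f x * g' x) :=
  ⟨fun a b => (h.ac a b).mul (h'.ac a b), by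
    filter_upwards [h.ae_hasDerivAt, h'.ae_hasDerivAt] with x hx hx' using hx.mul hx'⟩

theorem const_add (h : LocACDeriv f g) (c : ℝ) : LocACDeriv (fun x => c + f x) g := by
  refine ⟨fun a b => ?_, ?_⟩
  · have := h.ac a b
    rw [absolutelyContinuousOnInterval_iff] at this ⊢
    simpa using this
  · filter_upwards [h.ae_hasDerivAt] with x hx using hx.const_add c

/-- Chain rule for a function which is differentiable near the compact range of `f`. -/
theorem comp {A A' : ℝ → ℝ} {a b : ℝ} (h : LocACDeriv f g) (hf : ∀ x, f x ∈ Icc a b)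
    (hA : ∀ x ∈ Icc a b, HasDerivAt A (A' x) x) (hA' : ContinuousOn A' (Icc a b)) :
    LocACDeriv (fun x => A (f x)) (fun x => A' (f x) * g x) := by
  obtain ⟨C, hC⟩ := isCompact_Icc.exists_bound_of_continuousOn hA'
  have hL : LipschitzOnWith (Real.toNNReal C) A (Icc a b) := by
    refine (convex_Icc a b).lipschitzOnWith_of_nnnorm_hasDerivWithin_le
      (fun x hx => (hA x hx).hasDerivWithinAt) (fun x hx => ?_)
    rw [← NNReal.coe_le_coe, coe_nnnorm]
    exact (hC x hx).trans (Real.le_coe_toNNReal C)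
  refine ⟨fun c d => AbsolutelyContinuousOnInterval.lipschitzOnWith_comp hL hf (h.ac c d), ?_⟩
  filter_upwards [h.ae_hasDerivAt] with x hx using (hA _ (hf x)).comp x hx

theorem of_locallyIntegrable (hg : LocallyIntegrable g volume) :
    LocACDeriv (fun x => ∫ t in (0 : ℝ)..x, g t) g := by
  refine ⟨fun a b => ?_, ?_⟩
  -- The interval is enlarged so as to contain the base point `0` of the primitive.
  · have h : IntervalIntegrable g volume (min (min a b) 0) (max (max a b) 0) :=
      (hg.integrableOn_isCompact isCompact_uIcc).intervalIntegrable
    have hle : min (min a b) 0 ≤ max (max a b) 0 := by grind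
    refine (h.absolutelyContinuousOnInterval_intervalIntegral (c := 0) ?_).mono ?_
    · rw [uIcc_of_le hle]; constructor <;> grind
    · rw [uIcc_of_le hle]
      intro x hx
      rw [uIcc, mem_Icc] at hx
      constructor <;> grind
  · filter_upwards [_root_.LocallyIntegrable.ae_hasDerivAt_integral hg] with x hx using hx 0

theorem of_contDiff (hf : ContDiff ℝ 1 f) : LocACDeriv f (deriv f) :=
  ⟨fun _ _ => hf.contDiffOn.absolutelyContinuousOnInterval,
    Filter.Eventually.of_forall fun x => (hf.differentiable (by simp) x).hasDerivAt⟩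

theorem hasWeakDeriv (h : LocACDeriv f g) : HasWeakDeriv f g := by
  refine ⟨h.continuous.locallyIntegrable, h.locallyIntegrable, fun ψ hψ hc => ?_⟩
  have hψ' := of_contDiff (hψ.of_le (m := 1) (by simp))
  have hd : Continuous (deriv ψ) := hψ.continuous_deriv (by simp)
  have i1 : Integrable (fun z => f z * deriv ψ z) :=
    h.continuous.locallyIntegrable.integrable_smul_right_of_hasCompactSupport hd hc.deriv
  have i3 : Integrable (fun z => g z * ψ z) :=
    h.locallyIntegrable.integrable_smul_right_of_hasCompactSupport hψ.continuous hc
  obtain ⟨R, hR, hR'⟩ := hc.isCompact.isBounded.subset_ball_lt 0 0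
  have hz : ∀ x, x ∉ Ioo (-R) R → ψ x = 0 := fun x hx => by
    by_contra h0
    have := hR' (subset_tsupport _ h0)
    rw [Real.ball_eq_Ioo] at this
    simp at this hx
    grind
  -- Integration by parts: `f ψ` vanishes at both ends of an interval that contains the support of
  -- `ψ`.
  have key := (h.mul hψ').integral_eq (-R) R
  rw [hz R (by simp), hz (-R) (by simp), intervalIntegral.integral_of_le (by linarith)] at key
  rw [setIntegral_eq_integral_of_forall_compl_eq_zero, integral_add i3 i1] at key
  · linarith
  · intro x hx
    have h1 : x ∉ Ioo (-R) R := fun h => hx ⟨h.1, h.2.le⟩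
    have h2 : deriv ψ x = 0 := by
      have : x ∉ tsupport ψ := fun hmem => by
        have := hR' hmem
        rw [Real.ball_eq_Ioo] at this
        simp at this h1
        grind
      by_contra h0
      exact this (support_deriv_subset h0)
    simp [hz x h1, h2]

/-- If `f` and its derivative are integrable, the derivative has integral zero. -/
theorem integral_eq_zero (h : LocACDeriv f g) (hf : Integrable f) (hg : Integrable g) :
    ∫ x, g x = 0 := by
  have h1 : Filter.Tendsto (fun R : ℝ => ∫ x in (-R)..R, g x) Filter.atTop
      (nhds (∫ x, g x)) :=
    intervalIntegral_tendsto_integral hg Filter.tendsto_neg_atTop_atBot Filter.tendsto_id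
  simp only [h.integral_eq] at h1
  -- An integrable function that has a limit at infinity has limit zero, so no decay of `f` itself
  -- is needed.
  have h2 : Integrable (fun R => f R - f (-R)) := hf.sub hf.comp_neg
  refine IntegrableAtFilter.eq_zero_of_tendsto (h2.integrableAtFilter Filter.atTop) ?_ h1
  intro s hs
  obtain ⟨a, ha⟩ := Filter.mem_atTop_sets.1 hs
  rw [← top_le_iff, ← Real.volume_Ici (a := a)]
  exact measure_mono ha

end LocACDeriv

/-! ### Weak derivatives and absolutely continuous representatives. -/

/-- Du Bois-Reymond's argument. Fix a bump `r` of mass one. For a test function `θ` of mass `I`, the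
function `θ - I r` has mean zero, so it is the derivative of a test function and `f` annihilates it.
Hence `f - ∫ f r` annihilates every `θ`. -/
theorem HasWeakDeriv.ae_const {f : ℝ → ℝ} (h : HasWeakDeriv f 0) :
    ∃ c : ℝ, f =ᵐ[volume] fun _ => c := by
  let ρ : ContDiffBump (0 : ℝ) := ⟨1, 2, by norm_num, by norm_num⟩
  let r : ℝ → ℝ := ρ.normed volume
  have hr : ContDiff ℝ ∞ r := ρ.contDiff_normed
  have hrc : HasCompactSupport r := ρ.hasCompactSupport_normed
  have hr1 : ∫ x, r x = 1 := ρ.integral_normed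
  refine ⟨∫ x, f x * r x, ?_⟩
  have key : ∀ᵐ x, f x - (∫ x, f x * r x) = 0 := by
    refine ae_eq_zero_of_integral_contDiff_smul_eq_zero
      (h.1.sub (locallyIntegrable_const _)) fun θ hθ hθc => ?_
    set I := ∫ x, θ x with hI
    let η : ℝ → ℝ := fun x => θ x - I * r x
    have hη : ContDiff ℝ ∞ η := hθ.sub (contDiff_const.mul hr)
    have hηc : HasCompactSupport η := hθc.sub hrc.mul_left
    have iθ : Integrable θ := hθ.continuous.integrable_of_hasCompactSupport hθc
    have ir : Integrable r := hr.continuous.integrable_of_hasCompactSupport hrc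
    have hη0 : ∫ x, η x = 0 := by
      rw [integral_sub iθ (ir.const_mul I), integral_const_mul, hr1, ← hI]; ring
    obtain ⟨R, hR, hR'⟩ := hηc.isCompact.isBounded.subset_ball_lt 0 0
    have hz : ∀ x, x ∉ Ioo (-R) R → η x = 0 := fun x hx => by
      by_contra h0
      have := hR' (subset_tsupport _ h0)
      rw [Real.ball_eq_Ioo] at this
      exact hx (by simpa using this)
    let ψ : ℝ → ℝ := fun x => ∫ t in (-R)..x, η t
    have hψd : ∀ x, HasDerivAt ψ (η x) x := fun x =>
      hη.continuous.integral_hasStrictDerivAt _ _ |>.hasDerivAt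
    have hψ' : deriv ψ = η := funext fun x => (hψd x).deriv
    have hψ : ContDiff ℝ ∞ ψ := by
      rw [contDiff_infty_iff_deriv, hψ']
      exact ⟨fun x => (hψd x).differentiableAt, hη⟩
    have hψc : HasCompactSupport ψ := by
      refine HasCompactSupport.intro (isCompact_Icc (a := -R) (b := R)) fun x hx => ?_
      rcases lt_or_ge x (-R) with hx1 | hx1
      · have : ∀ t ∈ uIcc (-R) x, η t = (fun _ => (0 : ℝ)) t := fun t ht => by
          rw [uIcc_of_ge hx1.le] at ht
          exact hz t fun h => absurd h.1 (not_lt.2 ht.2)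
        change ∫ t in (-R)..x, η t = 0
        rw [intervalIntegral.integral_congr this]; simp
      · have hx2 : R < x := by
          by_contra hcon
          exact hx ⟨hx1, not_lt.1 hcon⟩
        change ∫ t in (-R)..x, η t = 0
        rw [intervalIntegral.integral_of_le hx1,
          setIntegral_eq_integral_of_forall_compl_eq_zero, hη0]
        intro y hy
        exact hz y fun h => hy ⟨h.1, h.2.le.trans hx2.le⟩
    have h0 := h.2.2 ψ hψ hψc
    simp only [hψ', Pi.zero_apply, zero_mul, integral_zero, neg_zero] at h0
    have i1 : Integrable (fun z => f z * θ z) :=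
      h.1.integrable_smul_right_of_hasCompactSupport hθ.continuous hθc
    have i2 : Integrable (fun z => f z * r z) :=
      h.1.integrable_smul_right_of_hasCompactSupport hr.continuous hrc
    have e1 : ∫ z, f z * η z = (∫ z, f z * θ z) - I * ∫ z, f z * r z := by
      rw [← integral_const_mul, ← integral_sub i1 (i2.const_mul I)]
      congr 1; ext z; simp only [η]; ring
    have e2 : ∫ x, θ x • (f x - ∫ x, f x * r x) =
        (∫ z, f z * θ z) - I * ∫ z, f z * r z := by
      rw [hI, ← integral_mul_const, ← integral_sub i1 (iθ.mul_const _)]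
      congr 1; ext z; simp only [smul_eq_mul]; ring
    rw [e2, ← e1, h0]
  filter_upwards [key] with x hx using sub_eq_zero.1 hx

/-- A function with a weak derivative has a locally absolutely continuous representative. -/
theorem HasWeakDeriv.exists_locACDeriv {f g : ℝ → ℝ} (h : HasWeakDeriv f g) :
    ∃ F : ℝ → ℝ, f =ᵐ[volume] F ∧ LocACDeriv F g := by
  have hG := LocACDeriv.of_locallyIntegrable h.2.1
  have h0 : HasWeakDeriv (f + (-1 : ℝ) • fun x => ∫ t in (0 : ℝ)..x, g t) 0 :=
    (h.add (hG.hasWeakDeriv.smul (-1))).congr (by rfl) (by filter_upwards with x; simp)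
  obtain ⟨c, hc⟩ := h0.ae_const
  refine ⟨_, ?_, hG.const_add c⟩
  filter_upwards [hc] with x hx
  simp at hx
  linarith

theorem HasWeakDeriv.locACDeriv {f g : ℝ → ℝ} (h : HasWeakDeriv f g) (hf : Continuous f) :
    LocACDeriv f g := by
  obtain ⟨F, hF, hFg⟩ := h.exists_locACDeriv
  rwa [(hf.ae_eq_iff_eq volume hFg.continuous).1 hF]

theorem HasWeakDeriv.ae_unique {f f' g g' : ℝ → ℝ} (h : HasWeakDeriv f g)
    (h' : HasWeakDeriv f' g') (hf : f =ᵐ[volume] f') : g =ᵐ[volume] g' := by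
  obtain ⟨F, hF, hFg⟩ := h.exists_locACDeriv
  exact hFg.ae_unique ((h'.congr (hF.symm.trans hf) (by rfl)).locACDeriv hFg.continuous)

/-! ### The space `H¹` and its embedding in bounded functions. -/

namespace SobolevSpace

variable {k : ℕ}

theorem memLp_wderiv (p : SobolevSpace k) (j : Fin (k + 1)) :
    MemLp (wderiv p j) 2 volume :=
  Lp.memLp _

theorem integrable_mul {f g : ℝ → ℝ} (hf : MemLp f 2 volume) (hg : MemLp g 2 volume) :
    Integrable fun x => f x * g x :=
  hf.integrable_mul hg

theorem integrable_wderiv_sq (p : SobolevSpace k) (j : Fin (k + 1)) :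
    Integrable fun x => wderiv p j x ^ 2 :=
  (memLp_wderiv p j).integrable_sq

theorem wderiv_add (p q : SobolevSpace k) (j : Fin (k + 1)) :
    wderiv (p + q) j =ᵐ[volume] fun x => wderiv p j x + wderiv q j x :=
  Lp.coeFn_add (wderiv p j) (wderiv q j)

theorem wderiv_sub (p q : SobolevSpace k) (j : Fin (k + 1)) :
    wderiv (p - q) j =ᵐ[volume] fun x => wderiv p j x - wderiv q j x :=
  Lp.coeFn_sub (wderiv p j) (wderiv q j)

theorem wderiv_smul (c : ℝ) (p : SobolevSpace k) (j : Fin (k + 1)) :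
    wderiv (c • p) j =ᵐ[volume] fun x => c * wderiv p j x :=
  Lp.coeFn_smul c (wderiv p j)

theorem norm_sq_eq (p : SobolevSpace 1) :
    ‖p‖ ^ 2 = (∫ x, wderiv p 0 x ^ 2) + ∫ x, wderiv p 1 x ^ 2 := by
  have h : ∀ f : Lp ℝ 2 (volume : Measure ℝ), ‖f‖ ^ 2 = ∫ x, f x ^ 2 := fun f => by
    rw [← real_inner_self_eq_norm_sq, L2.inner_def]
    simp [sq]
  rw [show ‖p‖ = ‖p.1‖ from rfl, PiLp.norm_sq_eq_of_L2, Fin.sum_univ_two, h, h]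
  rfl

theorem hasWeakDeriv (p : SobolevSpace 1) : HasWeakDeriv (wderiv p 0) (wderiv p 1) :=
  p.2 0

/-- The element of `H¹(ℝ)` given by a square integrable function and its weak derivative. -/
noncomputable def ofMemLp {f g : ℝ → ℝ} (hf : MemLp f 2 volume) (hg : MemLp g 2 volume)
    (h : HasWeakDeriv f g) : SobolevSpace 1 :=
  ⟨WithLp.toLp 2 ![hf.toLp f, hg.toLp g], fun j => by
    have : j = 0 := Subsingleton.elim _ _
    subst this
    exact h.congr hf.coeFn_toLp hg.coeFn_toLp⟩

theorem wderiv_ofMemLp_zero {f g : ℝ → ℝ} (hf : MemLp f 2 volume) (hg : MemLp g 2 volume)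
    (h : HasWeakDeriv f g) : wderiv (ofMemLp hf hg h) 0 =ᵐ[volume] f :=
  hf.coeFn_toLp

theorem wderiv_ofMemLp_one {f g : ℝ → ℝ} (hf : MemLp f 2 volume) (hg : MemLp g 2 volume)
    (h : HasWeakDeriv f g) : wderiv (ofMemLp hf hg h) 1 =ᵐ[volume] g :=
  hg.coeFn_toLp

/-- The inclusion of `H^k(ℝ)` in `H¹(ℝ)`. -/
noncomputable def toOne (hk : 1 ≤ k) : SobolevSpace k →L[ℝ] SobolevSpace 1 :=
  ContinuousLinearMap.codRestrict
    ((PiLp.continuousLinearEquiv 2 ℝ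
        (fun _ : Fin 2 => Lp ℝ 2 (volume : Measure ℝ))).symm.toContinuousLinearMap.comp
      ((ContinuousLinearMap.pi fun j : Fin 2 =>
        PiLp.proj 2 (fun _ : Fin (k + 1) => Lp ℝ 2 (volume : Measure ℝ))
          (Fin.castLE (by omega) j)).comp (SobolevSpace k).subtypeL))
    (SobolevSpace 1) fun p j => by
      have : j = 0 := Subsingleton.elim _ _
      subst this
      exact p.2 (Fin.castLE hk 0)

theorem ext_of_represents {p q : SobolevSpace 1} {f : ℝ → ℝ} (hp : Represents p f)
    (hq : Represents q f) : p = q := by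
  have h0 : wderiv p 0 =ᵐ[volume] wderiv q 0 := hp.trans hq.symm
  have h1 := (hasWeakDeriv p).ae_unique (hasWeakDeriv q) h0
  apply Subtype.ext
  apply PiLp.ext
  intro j
  fin_cases j
  · exact Lp.ext h0
  · exact Lp.ext h1

theorem sobolevENorm_eq {p : SobolevSpace 1} {f : ℝ → ℝ} (hp : Represents p f) :
    sobolevENorm 1 f = ENNReal.ofReal ‖p‖ := by
  rw [ofReal_norm]
  refine le_antisymm (iInf₂_le p hp) (le_iInf₂ fun q hq => ?_)
  rw [ext_of_represents hp hq]

/-- Since `|(f²)'| = |2 f f'| ≤ f² + f'²`, the values of `f²` at two points differ by at most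
`‖p‖²`. If `f(x)² > ‖p‖²`, then `f²` is bounded below by a positive constant on the whole line,
which contradicts its integrability. -/
theorem abs_le_norm {p : SobolevSpace 1} {f : ℝ → ℝ} (hp : wderiv p 0 =ᵐ[volume] f)
    (hf : LocACDeriv f (wderiv p 1)) (x : ℝ) : |f x| ≤ ‖p‖ := by
  refine abs_le_of_sq_le_sq ?_ (norm_nonneg _)
  by_contra! hlt
  have if2 : Integrable fun x => f x ^ 2 :=
    (integrable_wderiv_sq p 0).congr (by filter_upwards [hp] with x hx; rw [hx])
  have ig2 := integrable_wderiv_sq p 1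
  have hN : ‖p‖ ^ 2 = ∫ x, (f x ^ 2 + wderiv p 1 x ^ 2) := by
    rw [norm_sq_eq, integral_add if2 ig2]
    congr 1
    exact integral_congr_ae (by filter_upwards [hp] with x hx; rw [hx])
  have hy : ∀ y, f x ^ 2 - ‖p‖ ^ 2 ≤ f y ^ 2 := fun y => by
    have h1 := (hf.mul hf).integral_eq y x
    have h2 : ‖∫ t in y..x, (wderiv p 1 t * f t + f t * wderiv p 1 t)‖ ≤ ‖p‖ ^ 2 := by
      rw [intervalIntegral.norm_integral_eq_norm_integral_uIoc, hN]
      refine (norm_integral_le_of_norm_le (if2.add ig2).integrableOn ?_).trans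
        (setIntegral_le_integral (if2.add ig2) ?_)
      · refine Filter.Eventually.of_forall fun t => ?_
        rw [Real.norm_eq_abs, abs_le, Pi.add_apply]
        constructor <;> nlinarith [sq_nonneg (f t + wderiv p 1 t),
          sq_nonneg (f t - wderiv p 1 t)]
      · exact Filter.Eventually.of_forall fun t => by
          simp only [Pi.zero_apply, Pi.add_apply]; positivity
    rw [h1] at h2
    have := (abs_le.1 h2).2
    nlinarith
  have hc : Integrable (fun _ : ℝ => f x ^ 2 - ‖p‖ ^ 2) :=
    if2.mono' aestronglyMeasurable_const (Filter.Eventually.of_forall fun y => by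
      rw [Real.norm_eq_abs, abs_of_pos (by linarith)]; exact hy y)
  rw [integrable_const_iff] at hc
  rcases hc with hc | hc
  · linarith
  · exact absurd hc.measure_univ_lt_top (by simp)

/-- The continuous representative of an element of `H¹(ℝ)`. -/
theorem exists_rep (p : SobolevSpace 1) :
    ∃ f : ℝ → ℝ, wderiv p 0 =ᵐ[volume] f ∧ LocACDeriv f (wderiv p 1) ∧ ∀ x, |f x| ≤ ‖p‖ := by
  obtain ⟨f, hf, h⟩ := (hasWeakDeriv p).exists_locACDeriv
  exact ⟨f, hf, h, abs_le_norm hf h⟩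

theorem ae_abs_le (p : SobolevSpace 1) : ∀ᵐ x, |wderiv p 0 x| ≤ ‖p‖ := by
  obtain ⟨f, hf, -, h⟩ := exists_rep p
  filter_upwards [hf] with x hx
  rw [hx]
  exact h x

end SobolevSpace

/-! ### Taylor bounds on `[1/2, 3/2]`. -/

/-- First and second order bounds, with constant `C`, for a function `A` with derivative `A'` on
`[1/2, 3/2]`. -/
structure TaylorBound (A A' : ℝ → ℝ) (C : ℝ) : Prop where
  nonneg : 0 ≤ C
  continuousOn : ContinuousOn A (Icc (1 / 2) (3 / 2))
  continuousOn_deriv : ContinuousOn A' (Icc (1 / 2) (3 / 2))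
  abs_le : ∀ x ∈ Icc (1 / 2 : ℝ) (3 / 2), |A x| ≤ C
  abs_deriv_le : ∀ x ∈ Icc (1 / 2 : ℝ) (3 / 2), |A' x| ≤ C
  lipschitz : ∀ x ∈ Icc (1 / 2 : ℝ) (3 / 2), ∀ y ∈ Icc (1 / 2 : ℝ) (3 / 2),
    |A y - A x| ≤ C * |y - x|
  lipschitz_deriv : ∀ x ∈ Icc (1 / 2 : ℝ) (3 / 2), ∀ y ∈ Icc (1 / 2 : ℝ) (3 / 2),
    |A' y - A' x| ≤ C * |y - x|
  taylor : ∀ x ∈ Icc (1 / 2 : ℝ) (3 / 2), ∀ y ∈ Icc (1 / 2 : ℝ) (3 / 2),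
    |A y - A x - A' x * (y - x)| ≤ C * (y - x) ^ 2

theorem TaylorBound.mono {A A' : ℝ → ℝ} {C D : ℝ} (h : TaylorBound A A' C) (hCD : C ≤ D) :
    TaylorBound A A' D where
  nonneg := h.nonneg.trans hCD
  continuousOn := h.continuousOn
  continuousOn_deriv := h.continuousOn_deriv
  abs_le x hx := (h.abs_le x hx).trans hCD
  abs_deriv_le x hx := (h.abs_deriv_le x hx).trans hCD
  lipschitz x hx y hy := (h.lipschitz x hx y hy).trans (by gcongr)
  lipschitz_deriv x hx y hy := (h.lipschitz_deriv x hx y hy).trans (by gcongr)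
  taylor x hx y hy := (h.taylor x hx y hy).trans (by gcongr)

theorem exists_taylorBound {A A' A'' : ℝ → ℝ}
    (hA : ∀ x, 0 < x → HasDerivAt A (A' x) x) (hA' : ∀ x, 0 < x → HasDerivAt A' (A'' x) x)
    (hA'' : ContinuousOn A'' (Ioi 0)) : ∃ C, TaylorBound A A' C := by
  have hJ : ∀ x ∈ Icc (1 / 2 : ℝ) (3 / 2), 0 < x := fun x hx => by linarith [hx.1]
  have c0 : ContinuousOn A (Icc (1 / 2) (3 / 2)) := fun x hx =>
    (hA x (hJ x hx)).continuousAt.continuousWithinAt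
  have c1 : ContinuousOn A' (Icc (1 / 2) (3 / 2)) := fun x hx =>
    (hA' x (hJ x hx)).continuousAt.continuousWithinAt
  obtain ⟨C₀, h0⟩ := isCompact_Icc.exists_bound_of_continuousOn c0
  obtain ⟨C₁, h1⟩ := isCompact_Icc.exists_bound_of_continuousOn c1
  obtain ⟨C₂, h2⟩ := isCompact_Icc.exists_bound_of_continuousOn (hA''.mono hJ)
  have lip : ∀ x ∈ Icc (1 / 2 : ℝ) (3 / 2), ∀ y ∈ Icc (1 / 2 : ℝ) (3 / 2),
      |A y - A x| ≤ C₁ * |y - x| := fun x hx y hy =>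
    (convex_Icc _ _).norm_image_sub_le_of_norm_hasDerivWithin_le
      (fun z hz => (hA z (hJ z hz)).hasDerivWithinAt) h1 hx hy
  have lip' : ∀ x ∈ Icc (1 / 2 : ℝ) (3 / 2), ∀ y ∈ Icc (1 / 2 : ℝ) (3 / 2),
      |A' y - A' x| ≤ C₂ * |y - x| := fun x hx y hy =>
    (convex_Icc _ _).norm_image_sub_le_of_norm_hasDerivWithin_le
      (fun z hz => (hA' z (hJ z hz)).hasDerivWithinAt) h2 hx hy
  have hC2 : 0 ≤ C₂ := (norm_nonneg _).trans (h2 1 (by norm_num))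
  have l0 : C₀ ≤ max C₀ (max C₁ C₂) := le_max_left _ _
  have l1 : C₁ ≤ max C₀ (max C₁ C₂) := (le_max_left _ _).trans (le_max_right _ _)
  have l2 : C₂ ≤ max C₀ (max C₁ C₂) := (le_max_right _ _).trans (le_max_right _ _)
  refine ⟨max C₀ (max C₁ C₂), hC2.trans l2, c0, c1, fun x hx => (h0 x hx).trans l0,
    fun x hx => (h1 x hx).trans l1, fun x hx y hy => (lip x hx y hy).trans (by gcongr),
    fun x hx y hy => (lip' x hx y hy).trans (by gcongr), fun x hx y hy => ?_⟩
  have hsub : uIcc x y ⊆ Icc (1 / 2 : ℝ) (3 / 2) := uIcc_subset_Icc hx hy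
  -- The mean value inequality is applied after subtracting the linear part; the remaining
  -- derivative is at most `C₂ |y - x|` between `x` and `y`.
  have key := (convex_uIcc x y).norm_image_sub_le_of_norm_hasDerivWithin_le
    (f := fun z => A z - A' x * z) (f' := fun z => A' z - A' x) (C := C₂ * |y - x|)
    (fun z hz => by
      have := ((hA z (hJ z (hsub hz))).sub ((hasDerivAt_id z).const_mul (A' x))).hasDerivWithinAt
        (s := uIcc x y)
      exact this.congr_deriv (by simp))
    (fun z hz => (lip' x hx z (hsub hz)).trans (by
      gcongr 1
      exact abs_sub_left_of_mem_uIcc hz))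
    left_mem_uIcc right_mem_uIcc
  rw [Real.norm_eq_abs, Real.norm_eq_abs, mul_assoc, abs_mul_abs_self] at key
  calc |A y - A x - A' x * (y - x)| = |A y - A' x * y - (A x - A' x * x)| := by congr 1; ring
    _ ≤ C₂ * ((y - x) * (y - x)) := key
    _ ≤ max C₀ (max C₁ C₂) * (y - x) ^ 2 := by rw [← sq]; gcongr

/-! ### Primitives, and coercivity of the potential. -/

/-- The primitive of `h` vanishing at `1`. -/
noncomputable def primitive (h : ℝ → ℝ) (x : ℝ) : ℝ := ∫ t in (1 : ℝ)..x, h t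

theorem primitive_one (h : ℝ → ℝ) : primitive h 1 = 0 := intervalIntegral.integral_same

theorem hasDerivAt_primitive {h : ℝ → ℝ} (hh : ContinuousOn h (Ioi 0)) {x : ℝ} (hx : 0 < x) :
    HasDerivAt (primitive h) (h x) x := by
  have hsub : uIcc 1 x ⊆ Ioi (0 : ℝ) := fun y hy => lt_of_lt_of_le (by simp [hx]) hy.1
  refine intervalIntegral.integral_hasDerivAt_right (hh.mono hsub).intervalIntegrable ?_
    (hh.continuousAt (Ioi_mem_nhds hx))
  exact hh.stronglyMeasurableAtFilter isOpen_Ioi x hx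

theorem continuousOn_primitive {h : ℝ → ℝ} (hh : ContinuousOn h (Ioi 0)) :
    ContinuousOn (primitive h) (Ioi 0) := fun _ hx =>
  (hasDerivAt_primitive hh hx).continuousAt.continuousWithinAt

theorem continuousOn_rpow_const_Ioi (s : ℝ) : ContinuousOn (fun x : ℝ => x ^ s) (Ioi 0) :=
  continuousOn_id.rpow_const fun _ hx => Or.inl (ne_of_gt hx)

theorem hasDerivAt_rpow_const (s : ℝ) {x : ℝ} (hx : 0 < x) :
    HasDerivAt (fun x : ℝ => x ^ s) (s * x ^ (s - 1)) x :=
  Real.hasDerivAt_rpow_const (Or.inl hx.ne')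

theorem exists_rpow_lower_bound (s : ℝ) :
    ∃ c : ℝ, 0 < c ∧ ∀ x ∈ Icc (1 / 2 : ℝ) (3 / 2), c ≤ x ^ s := by
  have hJ : Icc (1 / 2 : ℝ) (3 / 2) ⊆ Ioi 0 := fun x hx => by
    have := hx.1
    simp only [mem_Ioi]; linarith
  obtain ⟨x, hx, h⟩ := isCompact_Icc.exists_isMinOn (s := Icc (1 / 2 : ℝ) (3 / 2))
    ⟨1, by norm_num⟩ ((continuousOn_rpow_const_Ioi s).mono hJ)
  exact ⟨x ^ s, Real.rpow_pos_of_pos (hJ hx) s, fun y hy => h hy⟩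

/-- After subtracting `c/2 (x - 1)²` the second derivative is `h - c ≥ 0`. The difference is
therefore convex, with value and slope zero at `1`, so `1` is its minimum. -/
theorem primitive_primitive_lower_bound {h : ℝ → ℝ} (hh : ContinuousOn h (Ioi 0)) {c : ℝ}
    (hc : ∀ x ∈ Icc (1 / 2 : ℝ) (3 / 2), c ≤ h x) {x : ℝ} (hx : x ∈ Icc (1 / 2 : ℝ) (3 / 2)) :
    c / 2 * (x - 1) ^ 2 ≤ primitive (primitive h) x := by
  have hJ : ∀ x ∈ Icc (1 / 2 : ℝ) (3 / 2), 0 < x := fun x hx => by linarith [hx.1]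
  have hG : ∀ y ∈ Icc (1 / 2 : ℝ) (3 / 2),
      HasDerivAt (fun y => primitive h y - c * (y - 1)) (h y - c) y := fun y hy => by
    exact ((hasDerivAt_primitive hh (hJ y hy)).sub
      (((hasDerivAt_id y).sub_const 1).const_mul c)).congr_deriv (by simp)
  have hW : ∀ y ∈ Icc (1 / 2 : ℝ) (3 / 2),
      HasDerivAt (fun y => primitive (primitive h) y - c / 2 * (y - 1) ^ 2)
        (primitive h y - c * (y - 1)) y := fun y hy => by
    refine ((hasDerivAt_primitive (continuousOn_primitive hh) (hJ y hy)).sub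
      ((((hasDerivAt_id y).sub_const 1).pow 2).const_mul (c / 2))).congr_deriv ?_
    simp; ring
  have mono : MonotoneOn (fun y => primitive h y - c * (y - 1)) (Icc (1 / 2) (3 / 2)) :=
    monotoneOn_of_deriv_nonneg (convex_Icc _ _)
      (fun y hy => (hG y hy).continuousAt.continuousWithinAt)
      (fun y hy => (hG y (interior_subset hy)).differentiableAt.differentiableWithinAt)
      (fun y hy => by
        rw [(hG y (interior_subset hy)).deriv]
        linarith [hc y (interior_subset hy)])
  have h1 : (1 : ℝ) ∈ Icc (1 / 2 : ℝ) (3 / 2) := by norm_num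
  have conv : ConvexOn ℝ (Icc (1 / 2) (3 / 2))
      (fun y => primitive (primitive h) y - c / 2 * (y - 1) ^ 2) := by
    refine MonotoneOn.convexOn_of_deriv (convex_Icc _ _)
      (fun y hy => (hW y hy).continuousAt.continuousWithinAt)
      (fun y hy => (hW y (interior_subset hy)).differentiableAt.differentiableWithinAt) ?_
    refine (mono.mono interior_subset).congr fun y hy => ?_
    exact (hW y (interior_subset hy)).deriv.symm
  have hmin : IsMinOn (fun y => primitive (primitive h) y - c / 2 * (y - 1) ^ 2)
      (Icc (1 / 2) (3 / 2)) 1 := by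
    refine conv.isMinOn_of_rightDeriv_eq_zero (by rw [interior_Icc]; norm_num) ?_
    rw [(hW 1 h1).hasDerivWithinAt.derivWithin (uniqueDiffWithinAt_Ioi 1), primitive_one]
    ring
  have := hmin hx
  simp only [primitive_one, mem_ofPred_eq] at this
  linarith

/-! ### The energy on `H¹`: bounds and differentiability. -/

theorem one_add_mem_Icc {y N : ℝ} (hN : N ≤ 1 / 2) (hy : |y| ≤ N) :
    1 + y ∈ Icc (1 / 2 : ℝ) (3 / 2) := by
  have := abs_le.1 (hy.trans hN)
  constructor <;> linarith

/-- As `B` is controlled only on `[1/2, 3/2]`, measurability is obtained from the continuous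
representative, whose values all lie there. -/
theorem SobolevSpace.aestronglyMeasurable_comp {B : ℝ → ℝ} {p : SobolevSpace 1}
    (hB : ContinuousOn B (Icc (1 / 2) (3 / 2))) (hp : ‖p‖ ≤ 1 / 2) :
    AEStronglyMeasurable (fun x => B (1 + wderiv p 0 x)) volume := by
  obtain ⟨f, hf, hfd, hle⟩ := SobolevSpace.exists_rep p
  have hc : Continuous fun x => B (1 + f x) :=
    hB.comp_continuous (continuous_const.add hfd.continuous) fun x => one_add_mem_Icc hp (hle x)
  refine hc.aestronglyMeasurable.congr ?_
  filter_upwards [hf] with x hx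
  rw [hx]

/-- The energy density `½ A(1 + y) g² + V(1 + y)`. -/
noncomputable def energyDensity (A V : ℝ → ℝ) (y g : ℝ) : ℝ :=
  1 / 2 * A (1 + y) * g ^ 2 + V (1 + y)

/-- The energy `∫ (½ A(φ) φ_z² + V(φ))` of `φ = 1 + p`. -/
noncomputable def energy (A V : ℝ → ℝ) (p : SobolevSpace 1) : ℝ :=
  ∫ x, energyDensity A V (wderiv p 0 x) (wderiv p 1 x)

/-- The derivative of the energy density at `(y, g)` in direction `(ρ, γ)`. -/
noncomputable def energyDensityDeriv (A A' V' : ℝ → ℝ) (y g ρ γ : ℝ) : ℝ :=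
  (1 / 2 * A' (1 + y) * g ^ 2 + V' (1 + y)) * ρ + A (1 + y) * g * γ

section

variable {A A' V V' : ℝ → ℝ} {C : ℝ}

theorem TaylorBound.abs_le_sq (hV : TaylorBound V V' C) (h0 : V 1 = 0) (h0' : V' 1 = 0) {y : ℝ}
    (hy : 1 + y ∈ Icc (1 / 2 : ℝ) (3 / 2)) : |V (1 + y)| ≤ C * y ^ 2 := by
  simpa [h0, h0'] using hV.taylor 1 (by norm_num) _ hy

theorem TaylorBound.abs_deriv_le_abs (hV : TaylorBound V V' C) (h0' : V' 1 = 0) {y : ℝ}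
    (hy : 1 + y ∈ Icc (1 / 2 : ℝ) (3 / 2)) : |V' (1 + y)| ≤ C * |y| := by
  simpa [h0'] using hV.lipschitz_deriv 1 (by norm_num) _ hy

theorem abs_energyDensity_le (hA : TaylorBound A A' C) (hV : TaylorBound V V' C) (h0 : V 1 = 0)
    (h0' : V' 1 = 0) {y : ℝ} (g : ℝ) (hy : 1 + y ∈ Icc (1 / 2 : ℝ) (3 / 2)) :
    |energyDensity A V y g| ≤ C * (y ^ 2 + g ^ 2) := by
  have h1 := abs_le.1 (hV.abs_le_sq h0 h0' hy)
  have h2 := abs_le.1 (hA.abs_le _ hy)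
  have h3 := sq_nonneg g
  rw [energyDensity, abs_le]
  constructor <;> nlinarith

/-- The cubic term `g² ρ` is the reason for the pointwise bound `N` on `ρ`: with `g` only in `L²`,
it is integrable because `ρ` is bounded. -/
theorem abs_energyDensityDeriv_le (hA : TaylorBound A A' C) (hV : TaylorBound V V' C)
    (h0' : V' 1 = 0) {y : ℝ} (g γ : ℝ) {ρ N : ℝ} (hy : 1 + y ∈ Icc (1 / 2 : ℝ) (3 / 2))
    (hρ : |ρ| ≤ N) :
    |energyDensityDeriv A A' V' y g ρ γ| ≤
      C * (N + 1) * (y ^ 2 + g ^ 2 + (ρ ^ 2 + γ ^ 2)) := by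
  have hC := hA.nonneg
  have hN : 0 ≤ N := (abs_nonneg _).trans hρ
  have e1 : |1 / 2 * A' (1 + y) * g ^ 2 * ρ| ≤ C * g ^ 2 * N := by
    rw [abs_mul]
    refine mul_le_mul ?_ hρ (abs_nonneg _) (by positivity)
    have := abs_le.1 (hA.abs_deriv_le _ hy)
    rw [abs_le]
    constructor <;> nlinarith [sq_nonneg g]
  have e2 : |V' (1 + y) * ρ| ≤ C * (y ^ 2 + ρ ^ 2) := by
    rw [abs_mul]
    calc _ ≤ C * |y| * |ρ| := by gcongr; exact hV.abs_deriv_le_abs h0' hy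
      _ = C * (|y| * |ρ|) := by ring
      _ ≤ C * (y ^ 2 + ρ ^ 2) := by
        gcongr
        nlinarith [sq_nonneg (|y| - |ρ|), sq_abs y, sq_abs ρ, abs_nonneg y, abs_nonneg ρ]
  have e3 : |A (1 + y) * g * γ| ≤ C * (g ^ 2 + γ ^ 2) := by
    rw [mul_assoc, abs_mul]
    gcongr
    · exact hA.abs_le _ hy
    · rw [abs_le]
      constructor <;> nlinarith [sq_nonneg (g - γ), sq_nonneg (g + γ)]
  have : energyDensityDeriv A A' V' y g ρ γ =
      1 / 2 * A' (1 + y) * g ^ 2 * ρ + V' (1 + y) * ρ + A (1 + y) * g * γ := by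
    rw [energyDensityDeriv]; ring
  rw [this]
  refine (abs_add_three _ _ _).trans ?_
  have p1 : 0 ≤ C * N * (y ^ 2 + ρ ^ 2 + γ ^ 2) := by positivity
  nlinarith

/-- The terms with `ρ² g²` are not controlled by `L²` norms alone. Here `N` will be the `H¹` norm of
the increment, so that `N² g²` integrates to a quadratic quantity in it. -/
theorem abs_energyDensity_taylor (hA : TaylorBound A A' C) (hV : TaylorBound V V' C)
    {y y' : ℝ} (g g' : ℝ) {N : ℝ} (hy : 1 + y ∈ Icc (1 / 2 : ℝ) (3 / 2))
    (hy' : 1 + y' ∈ Icc (1 / 2 : ℝ) (3 / 2)) (hρ : |y' - y| ≤ N) :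
    |energyDensity A V y' g' - energyDensity A V y g -
        energyDensityDeriv A A' V' y g (y' - y) (g' - g)| ≤
      C * (N ^ 2 * g ^ 2 + ((y' - y) ^ 2 + (g' - g) ^ 2)) := by
  have hC := hA.nonneg
  have t1 := hA.taylor _ hy _ hy'
  have t2 := hV.taylor _ hy _ hy'
  have t3 := hA.abs_le _ hy'
  have t4 := hA.lipschitz _ hy _ hy'
  rw [show 1 + y' - (1 + y) = y' - y by ring] at t1 t2 t4
  set ρ := y' - y
  set γ := g' - g with hγ
  have hg : g' = g + γ := by rw [hγ]; ring
  have hρ2 : ρ ^ 2 ≤ N ^ 2 := sq_le_sq' (abs_le.1 hρ).1 (abs_le.1 hρ).2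
  have split : energyDensity A V y' g' - energyDensity A V y g -
        energyDensityDeriv A A' V' y g ρ γ =
      1 / 2 * (A (1 + y') - A (1 + y) - A' (1 + y) * ρ) * g ^ 2 + 1 / 2 * A (1 + y') * γ ^ 2 +
        (A (1 + y') - A (1 + y)) * (g * γ) + (V (1 + y') - V (1 + y) - V' (1 + y) * ρ) := by
    rw [energyDensity, energyDensity, energyDensityDeriv, hg]; ring
  have e1 : |1 / 2 * (A (1 + y') - A (1 + y) - A' (1 + y) * ρ) * g ^ 2| ≤
      1 / 2 * (C * ρ ^ 2) * g ^ 2 := by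
    rw [abs_mul, abs_mul, abs_of_nonneg (sq_nonneg g)]
    gcongr
    norm_num
  have e2 : |1 / 2 * A (1 + y') * γ ^ 2| ≤ 1 / 2 * C * γ ^ 2 := by
    rw [abs_mul, abs_mul, abs_of_nonneg (sq_nonneg γ)]
    gcongr
    norm_num
  have e3 : |(A (1 + y') - A (1 + y)) * (g * γ)| ≤ C * (1 / 2 * (ρ ^ 2 * g ^ 2 + γ ^ 2)) := by
    rw [abs_mul, abs_mul]
    calc _ ≤ C * |ρ| * (|g| * |γ|) := by gcongr
      _ = C * (|ρ| * |g| * |γ|) := by ring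
      _ ≤ _ := by
        refine mul_le_mul_of_nonneg_left ?_ hC
        have := two_mul_le_add_sq (|ρ| * |g|) |γ|
        rw [mul_pow, sq_abs, sq_abs, sq_abs] at this
        linarith
  rw [split]
  refine (abs_add_le _ _).trans ((add_le_add_left (abs_add_three _ _ _) _).trans ?_)
  have h5 : C * (ρ ^ 2 * g ^ 2) ≤ C * (N ^ 2 * g ^ 2) := by gcongr
  linarith

variable {p q r : SobolevSpace 1}

theorem SobolevSpace.integrable_sq_add_sq (p : SobolevSpace 1) :
    Integrable fun x => wderiv p 0 x ^ 2 + wderiv p 1 x ^ 2 :=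
  (integrable_wderiv_sq p 0).add (integrable_wderiv_sq p 1)

theorem SobolevSpace.integral_sq_add_sq (p : SobolevSpace 1) :
    ∫ x, (wderiv p 0 x ^ 2 + wderiv p 1 x ^ 2) = ‖p‖ ^ 2 := by
  rw [norm_sq_eq, integral_add (integrable_wderiv_sq p 0) (integrable_wderiv_sq p 1)]

theorem SobolevSpace.ae_one_add_mem (hp : ‖p‖ ≤ 1 / 2) :
    ∀ᵐ x, 1 + wderiv p 0 x ∈ Icc (1 / 2 : ℝ) (3 / 2) := by
  filter_upwards [ae_abs_le p] with x hx using one_add_mem_Icc hp hx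

theorem integrable_energyDensity (hA : TaylorBound A A' C) (hV : TaylorBound V V' C)
    (h0 : V 1 = 0) (h0' : V' 1 = 0) (hp : ‖p‖ ≤ 1 / 2) :
    Integrable fun x => energyDensity A V (wderiv p 0 x) (wderiv p 1 x) := by
  refine ((SobolevSpace.integrable_sq_add_sq p).const_mul C).mono' ?_ ?_
  · exact (((SobolevSpace.aestronglyMeasurable_comp hA.continuousOn hp).const_mul _).mul
      ((Lp.aestronglyMeasurable _).pow 2)).add
      (SobolevSpace.aestronglyMeasurable_comp hV.continuousOn hp)
  · filter_upwards [SobolevSpace.ae_one_add_mem hp] with x hx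
    exact abs_energyDensity_le hA hV h0 h0' _ hx

theorem energy_le (hA : TaylorBound A A' C) (hV : TaylorBound V V' C)
    (h0 : V 1 = 0) (h0' : V' 1 = 0) (hp : ‖p‖ ≤ 1 / 2) : energy A V p ≤ C * ‖p‖ ^ 2 := by
  rw [← SobolevSpace.integral_sq_add_sq, ← integral_const_mul]
  refine integral_mono_ae (integrable_energyDensity hA hV h0 h0' hp)
    ((SobolevSpace.integrable_sq_add_sq p).const_mul C) ?_
  filter_upwards [SobolevSpace.ae_one_add_mem hp] with x hx
  exact (le_abs_self _).trans (abs_energyDensity_le hA hV h0 h0' _ hx)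

theorem le_energy (hA : TaylorBound A A' C) (hV : TaylorBound V V' C)
    (h0 : V 1 = 0) (h0' : V' 1 = 0) (hp : ‖p‖ ≤ 1 / 2) {c : ℝ}
    (hcA : ∀ x ∈ Icc (1 / 2 : ℝ) (3 / 2), c ≤ 1 / 2 * A x)
    (hcV : ∀ x ∈ Icc (1 / 2 : ℝ) (3 / 2), c * (x - 1) ^ 2 ≤ V x) :
    c * ‖p‖ ^ 2 ≤ energy A V p := by
  rw [← SobolevSpace.integral_sq_add_sq, ← integral_const_mul]
  refine integral_mono_ae ((SobolevSpace.integrable_sq_add_sq p).const_mul c)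
    (integrable_energyDensity hA hV h0 h0' hp) ?_
  filter_upwards [SobolevSpace.ae_one_add_mem hp] with x hx
  have h1 := hcV _ hx
  have h2 := mul_le_mul_of_nonneg_right (hcA _ hx) (sq_nonneg (wderiv p 1 x))
  rw [add_sub_cancel_left] at h1
  rw [energyDensity]
  linarith

theorem integrable_energyDensityDeriv (hA : TaylorBound A A' C) (hV : TaylorBound V V' C)
    (h0' : V' 1 = 0) (hp : ‖p‖ ≤ 1 / 2) (r : SobolevSpace 1) :
    Integrable fun x => energyDensityDeriv A A' V' (wderiv p 0 x) (wderiv p 1 x)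
      (wderiv r 0 x) (wderiv r 1 x) := by
  refine (((SobolevSpace.integrable_sq_add_sq p).add
    (SobolevSpace.integrable_sq_add_sq r)).const_mul (C * (‖r‖ + 1))).mono' ?_ ?_
  · exact (((((SobolevSpace.aestronglyMeasurable_comp hA.continuousOn_deriv hp).const_mul _).mul
      ((Lp.aestronglyMeasurable _).pow 2)).add
      (SobolevSpace.aestronglyMeasurable_comp hV.continuousOn_deriv hp)).mul
      (Lp.aestronglyMeasurable _)).add
      (((SobolevSpace.aestronglyMeasurable_comp hA.continuousOn hp).mul
        (Lp.aestronglyMeasurable _)).mul (Lp.aestronglyMeasurable _))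
  · filter_upwards [SobolevSpace.ae_one_add_mem hp, SobolevSpace.ae_abs_le r] with x hx hr
    exact abs_energyDensityDeriv_le hA hV h0' _ _ hx hr

/-- The derivative of the energy is a continuous linear functional on `H¹(ℝ)`. -/
theorem exists_energyDeriv (hA : TaylorBound A A' C) (hV : TaylorBound V V' C)
    (h0' : V' 1 = 0) (hp : ‖p‖ ≤ 1 / 2) :
    ∃ L : SobolevSpace 1 →L[ℝ] ℝ, ∀ r, L r =
      ∫ x, energyDensityDeriv A A' V' (wderiv p 0 x) (wderiv p 1 x)
        (wderiv r 0 x) (wderiv r 1 x) := by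
  let ℓ : SobolevSpace 1 →ₗ[ℝ] ℝ :=
    { toFun := fun r => ∫ x, energyDensityDeriv A A' V' (wderiv p 0 x) (wderiv p 1 x)
        (wderiv r 0 x) (wderiv r 1 x)
      map_add' := fun r s => by
        rw [← integral_add (integrable_energyDensityDeriv hA hV h0' hp r)
          (integrable_energyDensityDeriv hA hV h0' hp s)]
        refine integral_congr_ae ?_
        filter_upwards [SobolevSpace.wderiv_add r s 0, SobolevSpace.wderiv_add r s 1] with x h h'
        rw [h, h', energyDensityDeriv, energyDensityDeriv, energyDensityDeriv]
        ring
      map_smul' := fun c r => by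
        rw [RingHom.id_apply, smul_eq_mul, ← integral_const_mul]
        refine integral_congr_ae ?_
        filter_upwards [SobolevSpace.wderiv_smul c r 0, SobolevSpace.wderiv_smul c r 1]
          with x h h'
        rw [h, h', energyDensityDeriv, energyDensityDeriv]
        ring }
  -- The pointwise bound is not homogeneous in the direction, so boundedness is proved on the unit
  -- ball and extended by linearity.
  have hbound : ∀ z ∈ Metric.ball (0 : SobolevSpace 1) 1, ‖ℓ z‖ ≤ C * 2 * (‖p‖ ^ 2 + 1) := by
    intro r hr
    have hr1 : ‖r‖ ≤ 1 := (mem_ball_zero_iff.1 hr).le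
    have hC := hA.nonneg
    have hI := ((SobolevSpace.integrable_sq_add_sq p).add
      (SobolevSpace.integrable_sq_add_sq r)).const_mul (C * (‖r‖ + 1))
    have := norm_integral_le_of_norm_le hI (f := fun x =>
      energyDensityDeriv A A' V' (wderiv p 0 x) (wderiv p 1 x) (wderiv r 0 x) (wderiv r 1 x)) (by
        filter_upwards [SobolevSpace.ae_one_add_mem hp, SobolevSpace.ae_abs_le r] with x hx hr
        exact abs_energyDensityDeriv_le hA hV h0' _ _ hx hr)
    refine this.trans ?_
    simp only [Pi.add_apply]
    rw [integral_const_mul, integral_add (SobolevSpace.integrable_sq_add_sq p)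
      (SobolevSpace.integrable_sq_add_sq r), SobolevSpace.integral_sq_add_sq,
      SobolevSpace.integral_sq_add_sq]
    have h2 : ‖r‖ ^ 2 ≤ 1 := pow_le_one₀ (norm_nonneg _) hr1
    have h3 : ‖r‖ + 1 ≤ 2 := by linarith
    gcongr
  obtain ⟨D, hD⟩ := LinearMap.bound_of_ball_bound one_pos _ ℓ hbound
  exact ⟨ℓ.mkContinuous D hD, fun r => rfl⟩

theorem abs_energy_taylor (hA : TaylorBound A A' C) (hV : TaylorBound V V' C)
    (h0 : V 1 = 0) (h0' : V' 1 = 0) (hp : ‖p‖ ≤ 1 / 2) (hq : ‖q‖ ≤ 1 / 2)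
    {L : SobolevSpace 1 →L[ℝ] ℝ} (hL : ∀ r, L r =
      ∫ x, energyDensityDeriv A A' V' (wderiv p 0 x) (wderiv p 1 x)
        (wderiv r 0 x) (wderiv r 1 x)) :
    ‖energy A V q - energy A V p - L (q - p)‖ ≤ C * (‖p‖ ^ 2 + 1) * ‖q - p‖ ^ 2 := by
  have i1 := integrable_energyDensity hA hV h0 h0' hp
  have i2 := integrable_energyDensity hA hV h0 h0' hq
  have i3 := integrable_energyDensityDeriv hA hV h0' hp (q - p)
  have hC := hA.nonneg
  have hI : Integrable fun x => C * (‖q - p‖ ^ 2 * wderiv p 1 x ^ 2 +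
      (wderiv (q - p) 0 x ^ 2 + wderiv (q - p) 1 x ^ 2)) :=
    (((SobolevSpace.integrable_wderiv_sq p 1).const_mul _).add
      (SobolevSpace.integrable_sq_add_sq (q - p))).const_mul C
  have i21 : Integrable fun x => energyDensity A V (wderiv q 0 x) (wderiv q 1 x) -
      energyDensity A V (wderiv p 0 x) (wderiv p 1 x) := i2.sub i1
  rw [energy, energy, hL, ← integral_sub i2 i1, ← integral_sub i21 i3]
  refine (norm_integral_le_of_norm_le hI ?_).trans ?_
  · filter_upwards [SobolevSpace.ae_one_add_mem hp, SobolevSpace.ae_one_add_mem hq,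
      SobolevSpace.ae_abs_le (q - p), SobolevSpace.wderiv_sub q p 0,
      SobolevSpace.wderiv_sub q p 1] with x hx hx' hr e0 e1
    rw [e0] at hr
    rw [e0, e1]
    exact abs_energyDensity_taylor hA hV _ _ hx hx' hr
  · rw [integral_const_mul, integral_add ((SobolevSpace.integrable_wderiv_sq p 1).const_mul _)
      (SobolevSpace.integrable_sq_add_sq (q - p)), SobolevSpace.integral_sq_add_sq,
      integral_const_mul]
    have : ∫ x, wderiv p 1 x ^ 2 ≤ ‖p‖ ^ 2 := by
      rw [SobolevSpace.norm_sq_eq]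
      have : 0 ≤ ∫ x, wderiv p 0 x ^ 2 := integral_nonneg fun x => sq_nonneg _
      linarith
    calc _ ≤ C * (‖q - p‖ ^ 2 * ‖p‖ ^ 2 + ‖q - p‖ ^ 2) := by gcongr
      _ = _ := by ring

theorem hasFDerivAt_energy (hA : TaylorBound A A' C) (hV : TaylorBound V V' C)
    (h0 : V 1 = 0) (h0' : V' 1 = 0) (hp : ‖p‖ < 1 / 2)
    {L : SobolevSpace 1 →L[ℝ] ℝ} (hL : ∀ r, L r =
      ∫ x, energyDensityDeriv A A' V' (wderiv p 0 x) (wderiv p 1 x)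
        (wderiv r 0 x) (wderiv r 1 x)) :
    HasFDerivAt (energy A V) L p := by
  refine HasFDerivAt.of_isLittleO (Asymptotics.IsBigO.trans_isLittleO
    (g := fun q => ‖q - p‖ ^ 2) ?_ (Asymptotics.isLittleO_pow_sub_sub p one_lt_two))
  refine Asymptotics.IsBigO.of_bound (C * (‖p‖ ^ 2 + 1)) ?_
  -- The strict inequality `‖p‖ < 1/2` leaves a neighbourhood of `p` on which the Taylor estimate
  -- applies.
  filter_upwards [(continuous_norm.tendsto p).eventually_lt_const hp] with q hq
  rw [Real.norm_of_nonneg (sq_nonneg ‖q - p‖)]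
  exact abs_energy_taylor hA hV h0 h0' hp.le hq.le hL

end

/-! ### Stationarity of the energy along the flow. -/

theorem HasWeakDeriv.ae_eq_of_locACDeriv {f F g G : ℝ → ℝ} (h : HasWeakDeriv f g)
    (hF : LocACDeriv F G) (hf : f =ᵐ[volume] F) : g =ᵐ[volume] G :=
  h.ae_unique hF.hasWeakDeriv hf

section

variable {n m : ℝ} {φ : ℝ → ℝ} {p u r : SobolevSpace 1}

theorem LocACDeriv.rpow {φ g : ℝ → ℝ} (h : LocACDeriv φ g)
    (hφ : ∀ x, φ x ∈ Icc (1 / 2 : ℝ) (3 / 2)) (s : ℝ) :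
    LocACDeriv (fun x => φ x ^ s) (fun x => s * φ x ^ (s - 1) * g x) := by
  have hJ : ∀ x ∈ Icc (1 / 2 : ℝ) (3 / 2), 0 < x := fun x hx => by linarith [hx.1]
  exact h.comp hφ (fun x hx => hasDerivAt_rpow_const s (hJ x hx))
    (((continuousOn_rpow_const_Ioi (s - 1)).mono hJ).const_mul s)

/-- Along a solution, the derivative of `φᵐ u` is given by the product rule. -/
theorem wderiv_one_of_eq_rpow_mul (hφ : LocACDeriv φ (wderiv p 1))
    (hJ : ∀ x, φ x ∈ Icc (1 / 2 : ℝ) (3 / 2))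
    (hr : wderiv r 0 =ᵐ[volume] fun x => φ x ^ m * wderiv u 0 x) :
    wderiv r 1 =ᵐ[volume] fun x =>
      m * φ x ^ (m - 1) * wderiv p 1 x * wderiv u 0 x + φ x ^ m * wderiv u 1 x := by
  obtain ⟨U, hU, hUd, -⟩ := SobolevSpace.exists_rep u
  have h0 : wderiv r 0 =ᵐ[volume] fun x => φ x ^ m * U x := by
    filter_upwards [hr, hU] with x h1 h2
    rw [h1, h2]
  refine ((SobolevSpace.hasWeakDeriv r).ae_eq_of_locACDeriv ((hφ.rpow hJ m).mul hUd) h0).trans ?_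
  filter_upwards [hU] with x hx
  rw [hx]

theorem memLp_bounded_mul {B g : ℝ → ℝ} (hB : Continuous B) {C : ℝ} (hC : ∀ x, |B x| ≤ C)
    (hg : MemLp g 2 volume) : MemLp (fun x => B x * g x) 2 volume :=
  hg.of_le_mul (c := C) (hB.aestronglyMeasurable.mul hg.1)
    (Filter.Eventually.of_forall fun x => by
      rw [norm_mul]; exact mul_le_mul_of_nonneg_right (hC x) (norm_nonneg _))

/-- The test function `G(φ)`, where `G' = h` and `G(1) = 0`. -/
theorem exists_primitive_comp {h : ℝ → ℝ} (hh : ContinuousOn h (Ioi 0))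
    (hp : wderiv p 0 =ᵐ[volume] fun x => φ x - 1) (hφ : LocACDeriv φ (wderiv p 1))
    (hJ : ∀ x, φ x ∈ Icc (1 / 2 : ℝ) (3 / 2)) :
    ∃ v : SobolevSpace 1, wderiv v 0 =ᵐ[volume] (fun x => primitive h (φ x)) ∧
      wderiv v 1 =ᵐ[volume] fun x => h (φ x) * wderiv p 1 x := by
  have hpos : ∀ x ∈ Icc (1 / 2 : ℝ) (3 / 2), 0 < x := fun x hx => by linarith [hx.1]
  have hd := hφ.comp hJ (fun x hx => hasDerivAt_primitive hh (hpos x hx)) (hh.mono hpos)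
  obtain ⟨C, hC⟩ := isCompact_Icc.exists_bound_of_continuousOn (hh.mono hpos)
  -- Vanishing at `1` gives a bound by a multiple of `|φ - 1|`, which puts `primitive h ∘ φ` in
  -- `L²`.
  have hle : ∀ x ∈ Icc (1 / 2 : ℝ) (3 / 2), |primitive h x| ≤ C * |x - 1| := fun x hx => by
    have := (convex_Icc _ _).norm_image_sub_le_of_norm_hasDerivWithin_le
      (fun z hz => (hasDerivAt_primitive hh (hpos z hz)).hasDerivWithinAt) hC
      (show (1 : ℝ) ∈ Icc (1 / 2 : ℝ) (3 / 2) by norm_num) hx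
    rwa [primitive_one, sub_zero] at this
  have m0 : MemLp (fun x => primitive h (φ x)) 2 volume := by
    refine (SobolevSpace.memLp_wderiv p 0).of_le_mul (c := C)
      hd.continuous.aestronglyMeasurable ?_
    filter_upwards [hp] with x hx
    rw [hx]
    exact hle _ (hJ x)
  have m1 : MemLp (fun x => h (φ x) * wderiv p 1 x) 2 volume :=
    memLp_bounded_mul ((hh.mono hpos).comp_continuous hφ.continuous hJ)
      (fun x => hC _ (hJ x)) (SobolevSpace.memLp_wderiv p 1)
  exact ⟨SobolevSpace.ofMemLp m0 m1 hd.hasWeakDeriv,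
    SobolevSpace.wderiv_ofMemLp_zero m0 m1 hd.hasWeakDeriv,
    SobolevSpace.wderiv_ofMemLp_one m0 m1 hd.hasWeakDeriv⟩

/-- `∫ (φⁿ)_z G(φ) = 0`, being the integral of a total derivative. -/
theorem integral_rpow_deriv_mul_primitive_eq_zero {h : ℝ → ℝ}
    (hh : ContinuousOn h (Ioi 0))
    (hp : wderiv p 0 =ᵐ[volume] fun x => φ x - 1) (hφ : LocACDeriv φ (wderiv p 1))
    (hJ : ∀ x, φ x ∈ Icc (1 / 2 : ℝ) (3 / 2)) {g : Lp ℝ 2 (volume : Measure ℝ)}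
    (hg : HasWeakDeriv (fun z => φ z ^ n) g) {v : SobolevSpace 1}
    (hv : wderiv v 0 =ᵐ[volume] fun x => primitive h (φ x)) :
    ∫ x, g x * wderiv v 0 x = 0 := by
  have hpos : ∀ x ∈ Icc (1 / 2 : ℝ) (3 / 2), 0 < x := fun x hx => by linarith [hx.1]
  -- This choice makes `(φ^n)_z G(φ)` the derivative of `K(φ)`, where `K` is the primitive of `w`.
  let w : ℝ → ℝ := fun x => n * x ^ (n - 1) * primitive h x
  have hw : ∀ x, 0 < x → HasDerivAt w
      (n * ((n - 1) * x ^ (n - 1 - 1)) * primitive h x + n * x ^ (n - 1) * h x) x := fun x hx =>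
    ((hasDerivAt_rpow_const (n - 1) hx).const_mul n).mul (hasDerivAt_primitive hh hx)
  have hwc : ContinuousOn w (Ioi 0) := fun x hx => (hw x hx).continuousAt.continuousWithinAt
  have hw' : ContinuousOn (fun x => n * ((n - 1) * x ^ (n - 1 - 1)) * primitive h x +
      n * x ^ (n - 1) * h x) (Ioi 0) :=
    (((continuousOn_rpow_const_Ioi _).const_mul _).const_mul _ |>.mul
      (continuousOn_primitive hh)).add (((continuousOn_rpow_const_Ioi _).const_mul _).mul hh)
  obtain ⟨C, hC⟩ := exists_taylorBound (fun x hx => hasDerivAt_primitive hwc hx) hw hw'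
  have hK := hφ.comp hJ (fun x hx => hasDerivAt_primitive hwc (hpos x hx)) (hwc.mono hpos)
  have hgn := hg.ae_eq_of_locACDeriv (hφ.rpow hJ n) (by rfl)
  have hK' : LocACDeriv (fun x => primitive w (φ x)) (fun x => g x * wderiv v 0 x) := by
    refine hK.congr ?_
    filter_upwards [hgn, hv] with x h1 h2
    rw [h1, h2]
    simp only [w]
    ring
  refine hK'.integral_eq_zero ?_
    (SobolevSpace.integrable_mul (Lp.memLp g) (SobolevSpace.memLp_wderiv v 0))
  refine ((SobolevSpace.integrable_wderiv_sq p 0).const_mul C).mono'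
    hK.continuous.aestronglyMeasurable ?_
  filter_upwards [hp] with x hx
  rw [hx]
  -- Both `K` and `K' = w` vanish at `1`, so `|K(φ)| ≤ C (φ - 1)²`, which is integrable.
  have := hC.abs_le_sq (y := φ x - 1) (primitive_one w) (by simp [w, primitive_one])
    (by rw [add_sub_cancel]; exact hJ x)
  rwa [add_sub_cancel] at this

/-- The energy with `A(x) = x^{-2m}` and `V'' = x^{-m-n}` is stationary in the direction
`φᵐ u`, where `u` solves the elliptic equation. -/
theorem integral_energyDensityDeriv_eq_zero (hφc : Continuous φ) (hpn : ‖p‖ ≤ 1 / 2)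
    (hp : wderiv p 0 =ᵐ[volume] fun x => φ x - 1) (hu : SolvesElliptic n m φ u)
    (hr : wderiv r 0 =ᵐ[volume] fun x => φ x ^ m * wderiv u 0 x) :
    ∫ x, energyDensityDeriv (fun x => x ^ (-2 * m)) (fun x => -2 * m * x ^ (-2 * m - 1))
      (primitive fun x => x ^ (-m - n)) (wderiv p 0 x) (wderiv p 1 x)
        (wderiv r 0 x) (wderiv r 1 x) = 0 := by
  have hf : LocACDeriv (fun x => φ x - 1) (wderiv p 1) :=
    ((SobolevSpace.hasWeakDeriv p).congr hp.symm (by rfl)).locACDeriv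
      (hφc.sub continuous_const)
  have hφ : LocACDeriv φ (wderiv p 1) := by simpa using hf.const_add 1
  have hJ : ∀ x, φ x ∈ Icc (1 / 2 : ℝ) (3 / 2) := fun x => by
    have := one_add_mem_Icc hpn (SobolevSpace.abs_le_norm hp hf x)
    rwa [add_sub_cancel] at this
  obtain ⟨v, hv0, hv1⟩ := exists_primitive_comp (continuousOn_rpow_const_Ioi (-m - n)) hp hφ hJ
  obtain ⟨g, hg, hweak⟩ := hu
  have hz := integral_rpow_deriv_mul_primitive_eq_zero
    (continuousOn_rpow_const_Ioi (-m - n)) hp hφ hJ hg hv0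
  rw [← neg_eq_zero, ← hweak v] at hz
  rw [← hz]
  refine integral_congr_ae ?_
  filter_upwards [hp, hr, wderiv_one_of_eq_rpow_mul hφ hJ hr, hv0, hv1] with x h1 h2 h3 h4 h5
  have hx : 0 < φ x := by linarith [(hJ x).1]
  rw [h2, h3, h4, h5, h1, energyDensityDeriv, add_sub_cancel]
  have e1 : φ x ^ (-2 * m - 1) = φ x ^ (-2 * m) / φ x := Real.rpow_sub_one hx.ne' _
  have e2 : φ x ^ (m - 1) = φ x ^ m / φ x := Real.rpow_sub_one hx.ne' _
  have e3 : φ x ^ (-2 * m) * φ x ^ m = φ x ^ n * φ x ^ (-m - n) := by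
    rw [← Real.rpow_add hx, ← Real.rpow_add hx]
    ring_nf
  rw [e1, e2]
  -- The terms in `φ_z² u` cancel and those in `V'(φ)` agree; only the coefficients of `φ_z u_z`
  -- remain to be compared, and `e3` does this.
  linear_combination (wderiv p 1 x * wderiv u 1 x) * e3

end

/-! ### The continuity argument and the conclusion. -/

theorem mem_timeInterval_of_le {T : EReal} {s t : ℝ} (ht : t ∈ timeInterval T) (hs : 0 ≤ s)
    (hst : s ≤ t) : s ∈ timeInterval T :=
  ⟨hs, lt_of_le_of_lt (EReal.coe_le_coe_iff.2 hst) ht.2⟩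

/-- Used to turn derivatives within `[0, T)` into right derivatives, including at the endpoint `0`.
-/
theorem timeInterval_mem_nhdsGE {T : EReal} {s t : ℝ} (ht : t ∈ timeInterval T) (hs : 0 ≤ s)
    (hst : s < t) : timeInterval T ∈ nhdsWithin s (Ici s) :=
  Filter.mem_of_superset (Icc_mem_nhdsGE hst) fun _ hx =>
    mem_timeInterval_of_le ht (hs.trans hx.1) hx.2

/-- A continuous curve in a normed space cannot leave a small ball if a function comparable with
the squared norm is constant along it as long as it remains in the ball. -/
theorem norm_le_of_energy_const {H : Type*} [NormedAddCommGroup H] {q : ℝ → H} {E : H → ℝ}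
    {c C ε δ t : ℝ} (hδε : δ < ε) (hδ : C * δ ^ 2 < c * ε ^ 2) (hC : 0 ≤ C)
    (ht : 0 ≤ t) (hq : ContinuousOn q (Icc 0 t)) (h0 : ‖q 0‖ ≤ δ)
    (hlow : ∀ x, ‖x‖ ≤ ε → c * ‖x‖ ^ 2 ≤ E x) (hup : ∀ x, ‖x‖ ≤ ε → E x ≤ C * ‖x‖ ^ 2)
    (hE : ∀ s ∈ Icc 0 t, (∀ r ∈ Icc 0 s, ‖q r‖ ≤ ε) → E (q s) = E (q 0)) : ‖q t‖ ≤ ε := by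
  by_contra! hgt
  have hcn : ContinuousOn (fun s => ‖q s‖) (Icc 0 t) := hq.norm
  have hS : IsCompact (Icc 0 t ∩ (fun s => ‖q s‖) ⁻¹' Ici ε) :=
    isCompact_Icc.of_isClosed_subset
      (hcn.preimage_isClosed_of_isClosed isClosed_Icc isClosed_Ici) inter_subset_left
  -- `s` is the first time at which the norm reaches `ε`.
  obtain ⟨s, ⟨hs, hsε⟩, hmin⟩ := hS.exists_isLeast ⟨t, ⟨ht, le_rfl⟩, hgt.le⟩
  have hsε' : ε ≤ ‖q s‖ := hsε
  have hlt : ∀ r ∈ Icc 0 t, r < s → ‖q r‖ < ε := fun r hr hrs => by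
    by_contra! h
    exact absurd (hmin ⟨hr, h⟩) (not_le.2 hrs)
  -- By continuity the norm at time `s` is exactly `ε`, so the hypotheses on the closed ball still
  -- apply there.
  obtain ⟨r, hr, hrε⟩ : ε ∈ (fun s => ‖q s‖) '' Icc 0 s :=
    intermediate_value_Icc hs.1 (hcn.mono (Icc_subset_Icc_right hs.2))
      ⟨(h0.trans_lt hδε).le, hsε'⟩
  have hrs : r = s := by
    refine le_antisymm hr.2 (not_lt.1 fun h => ?_)
    exact (hlt r ⟨hr.1, hr.2.trans hs.2⟩ h).ne hrε
  rw [hrs] at hrε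
  have hrε' : ‖q s‖ = ε := hrε
  have hle : ∀ r ∈ Icc 0 s, ‖q r‖ ≤ ε := fun r hr => by
    rcases hr.2.lt_or_eq with h | h
    · exact (hlt r ⟨hr.1, hr.2.trans hs.2⟩ h).le
    · rw [h, hrε']
  -- These give `c ε² ≤ E(q s) = E(q 0) ≤ C δ²`, against the choice of `δ`.
  have h1 := hlow (q s) hrε'.le
  have h2 := hup (q 0) (h0.trans hδε.le)
  rw [hE s hs hle, hrε'] at h1
  have h3 : C * ‖q 0‖ ^ 2 ≤ C * δ ^ 2 := by gcongr
  linarith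

theorem exists_delta {c C ε : ℝ} (hc : 0 < c) (hC : 0 ≤ C) (hε : 0 < ε) :
    ∃ δ, 0 < δ ∧ δ < ε ∧ C * δ ^ 2 < c * ε ^ 2 := by
  -- With `δ = s ε`, the bounds `s ≤ 1/2` and `s (C + 1) ≤ c` give `C s² ≤ c/2 < c`.
  set s := min (1 / 2) (c / (C + 1))
  have hs : 0 < s := lt_min (by norm_num) (by positivity)
  have h1 : s ≤ 1 / 2 := min_le_left _ _
  have h2 : s * (C + 1) ≤ c := (le_div_iff₀ (by positivity)).1 (min_le_right _ _)
  refine ⟨s * ε, by positivity, by nlinarith, ?_⟩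
  have h3 : C * s ^ 2 < c := by nlinarith
  calc C * (s * ε) ^ 2 = C * s ^ 2 * ε ^ 2 := by ring
    _ < c * ε ^ 2 := by gcongr

theorem mainTheorem5 (n m : ℝ) :
    ∃ εc : ℝ, 0 < εc ∧ ∀ ε : ℝ, 0 < ε → ε < εc →
      ∃ δ : ℝ, 0 < δ ∧
        ∀ (k : ℕ) (T : EReal) (φ₀ : ℝ → ℝ) (φ : ℝ → ℝ → ℝ), 1 ≤ k → 0 < T →
          IsMagmaSolution n m k T φ₀ φ →
          sobolevENorm 1 (fun z => φ₀ z - 1) ≤ ENNReal.ofReal δ →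
          ∀ t : ℝ, 0 ≤ t → (t : EReal) < T →
            sobolevENorm 1 (fun z => φ t z - 1) ≤ ENNReal.ofReal ε := by
  set A : ℝ → ℝ := fun x => x ^ (-2 * m)
  set A' : ℝ → ℝ := fun x => -2 * m * x ^ (-2 * m - 1)
  set h : ℝ → ℝ := fun x => x ^ (-m - n)
  have hh : ContinuousOn h (Ioi 0) := continuousOn_rpow_const_Ioi _
  obtain ⟨C₁, hA₁⟩ : ∃ C, TaylorBound A A' C := exists_taylorBound
    (fun x hx => hasDerivAt_rpow_const (-2 * m) hx)
    (fun x hx => (hasDerivAt_rpow_const (-2 * m - 1) hx).const_mul (-2 * m))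
    (((continuousOn_rpow_const_Ioi _).const_mul _).const_mul _)
  obtain ⟨C₂, hV₂⟩ : ∃ C, TaylorBound (primitive (primitive h)) (primitive h) C :=
    exists_taylorBound (fun x hx => hasDerivAt_primitive (continuousOn_primitive hh) hx)
      (fun x hx => hasDerivAt_primitive hh hx) hh
  set C := max C₁ C₂
  have hA : TaylorBound A A' C := hA₁.mono (le_max_left _ _)
  have hV : TaylorBound (primitive (primitive h)) (primitive h) C := hV₂.mono (le_max_right _ _)
  have h0 : primitive (primitive h) 1 = 0 := primitive_one _
  have h0' : primitive h 1 = 0 := primitive_one _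
  obtain ⟨c₁, hc₁, hcA⟩ := exists_rpow_lower_bound (-2 * m)
  obtain ⟨c₂, hc₂, hch⟩ := exists_rpow_lower_bound (-m - n)
  set c := min (c₁ / 2) (c₂ / 2)
  have hc : 0 < c := lt_min (by positivity) (by positivity)
  have hcA' : ∀ x ∈ Icc (1 / 2 : ℝ) (3 / 2), c ≤ 1 / 2 * A x := fun x hx => by
    have : c₁ ≤ A x := hcA x hx
    linarith [min_le_left (c₁ / 2) (c₂ / 2)]
  have hcV : ∀ x ∈ Icc (1 / 2 : ℝ) (3 / 2), c * (x - 1) ^ 2 ≤ primitive (primitive h) x :=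
    fun x hx => (mul_le_mul_of_nonneg_right (min_le_right _ _) (sq_nonneg _)).trans
      (primitive_primitive_lower_bound hh hch hx)
  -- Below `1/2` the embedding confines `φ` to `[1/2, 3/2]`, for all `n` and `m`.
  refine ⟨1 / 2, by norm_num, fun ε hε hε2 => ?_⟩
  obtain ⟨δ, hδ, hδε, hCδ⟩ := exists_delta hc hA.nonneg hε
  refine ⟨δ, hδ, fun k T φ₀ φ hk _ hφ hinit t ht htT => ?_⟩
  obtain ⟨p, hp, hrep, heq⟩ := hφ.equation
  have htI : t ∈ timeInterval T := ⟨ht, htT⟩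
  -- The curve is viewed in `H¹`, where the energy lives; hence `δ` does not depend on `k`.
  set q : ℝ → SobolevSpace 1 := fun s => SobolevSpace.toOne hk (p s)
  have hqrep : ∀ s ∈ timeInterval T, Represents (q s) fun z => φ s z - 1 := hrep
  have hI : ∀ s ∈ Icc 0 t, s ∈ timeInterval T := fun s hs => mem_timeInterval_of_le htI hs.1 hs.2
  have hqd : ∀ s ∈ timeInterval T, HasDerivWithinAt q
      (SobolevSpace.toOne hk (derivWithin p (timeInterval T) s)) (timeInterval T) s :=
    fun s hs => (SobolevSpace.toOne hk).hasFDerivAt.comp_hasDerivWithinAt s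
      ((hp.differentiableOn one_ne_zero) s hs).hasDerivWithinAt
  have hEd : ∀ s ∈ timeInterval T, ‖q s‖ < 1 / 2 → HasDerivWithinAt
      (fun s => energy A (primitive (primitive h)) (q s)) 0 (timeInterval T) s := by
    intro s hs hlt
    obtain ⟨L, hL⟩ := exists_energyDeriv hA hV h0' hlt.le
    have hd := (hasFDerivAt_energy hA hV h0 h0' hlt hL).comp_hasDerivWithinAt s (hqd s hs)
    refine hd.congr_deriv ?_
    obtain ⟨u, hu, hur⟩ := heq s hs
    rw [hL]
    exact integral_energyDensityDeriv_eq_zero (hφ.continuous s hs) hlt.le (hqrep s hs) hu hur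
  rw [SobolevSpace.sobolevENorm_eq (hqrep t htI)]
  have h0I : (0 : ℝ) ∈ timeInterval T := hI 0 ⟨le_rfl, ht⟩
  rw [← hφ.initial, SobolevSpace.sobolevENorm_eq (hqrep 0 h0I),
    ENNReal.ofReal_le_ofReal_iff hδ.le] at hinit
  refine ENNReal.ofReal_le_ofReal (norm_le_of_energy_const (q := q)
    (E := energy A (primitive (primitive h))) hδε hCδ hA.nonneg ht
    (fun s hs => (hqd s (hI s hs)).continuousWithinAt.mono hI) hinit
    (fun x hx => le_energy hA hV h0 h0' (hx.trans hε2.le) hcA' hcV)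
    (fun x hx => energy_le hA hV h0 h0' (hx.trans hε2.le)) fun s hs hle => ?_)
  have hsub : ∀ r ∈ Icc 0 s, r ∈ timeInterval T := fun r hr => hI r ⟨hr.1, hr.2.trans hs.2⟩
  have hder : ∀ r ∈ Icc 0 s, HasDerivWithinAt
      (fun s => energy A (primitive (primitive h)) (q s)) 0 (timeInterval T) r := fun r hr =>
    hEd r (hsub r hr) ((hle r hr).trans_lt hε2)
  exact constant_of_has_deriv_right_zero
    (fun r hr => (hder r hr).continuousWithinAt.mono hsub)
    (fun r hr => (hder r ⟨hr.1, hr.2.le⟩).mono_of_mem_nhdsWithin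
      (timeInterval_mem_nhdsGE (hsub s ⟨hs.1, le_rfl⟩) hr.1 hr.2)) s ⟨hs.1, le_rfl⟩
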